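/- Let $X$ be a real Banach space with continuous dual $X^*$, let $C\subseteq X$ be closed and convex, and suppose that $$\mathrm{sqri}(C)=\{x\in C:\ \mathrm{cone}(C-x)\text{ is a closed linear subspace of }X\}\neq\emptyset,$$ where $\mathrm{cone}(U)=\bigcup_{t\ge 0}tU$. Let $F:C\times C\to\mathbb{R}$ satisfy $F(x,x)=0$ for all $x\in C$, and let $F$ be $BO$-maximal monotone (Blum--Oettli maximal monotone), i.e. $F$ is monotone ($F(x,y)+F(y,x)\le 0$ for all $x,y\in C$) and for every $(x,x^*)\in C\times X^*$ $$F(y,x)+\langle x^*,y-x\rangle\le 0\ \ \forall y\in C\quad\Longrightarrow\quad F(x,y)\ge\langle x^*,y-x\rangle\ \ \forall y\in C.$$ If $F(x,\cdot)$ is convex and lower semicontinuous on $C$ for all $x\in C$, then $F$ is maximal monotone, i.e. $F$ is monotone and the operator $A^F:X\rightrightarrows X^*$ given by $$A^F(x)=\{x^*\in X^*:\ F(x,y)-F(x,x)\ge\langle x^*,y-x\rangle\ \ \forall y\in C\}\ \text{ if }x\in C,\qquad A^F(x)=\emptyset\ \text{ otherwise},$$ is maximal monotone: it is monotone ($\langle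 y^*-x^*,y-x\rangle\ge 0$ whenever $x^*\in A^F(x)$, $y^*\in A^F(y)$) and its graph is not properly included in the graph of any other monotone operator $X\rightrightarrows X^*$. -/

import Mathlib

namespace BifunctionTheory

/-- The conical hull `⋃_{t ≥ 0} t U` of a set `U`. -/
def conicalHull {X : Type*} [AddCommGroup X] [Module ℝ X] (U : Set X) : Set X :=
  {z | ∃ t : ℝ, 0 ≤ t ∧ ∃ u ∈ U, z = t • u}

/-- The strong quasi relative interior of a (convex) set `U`: the points `x ∈ U` such that the
conical hull of `U - x` is a closed linear subspace. -/
def sqri {X : Type*} [AddCommGroup X] [Module ℝ X] [TopologicalSpace X] (U : Set X) : Set X :=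
  {x | x ∈ U ∧ ∃ V : Submodule ℝ X,
    IsClosed (V : Set X) ∧ conicalHull ((fun u => u - x) '' U) = (V : Set X)}

variable {X : Type*} [NormedAddCommGroup X] [NormedSpace ℝ X]

/-- The graph of a multifunction `T : X ⇉ X*`. -/
def graph (T : X → Set (StrongDual ℝ X)) : Set (X × StrongDual ℝ X) :=
  {p | p.2 ∈ T p.1}

/-- Monotone operators `T : X ⇉ X*`. -/
def IsMonotoneOperator (T : X → Set (StrongDual ℝ X)) : Prop :=
  ∀ x y : X, ∀ x' ∈ T x, ∀ y' ∈ T y, 0 ≤ (y' - x') (y - x)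

/-- Maximal monotone operators: monotone operators whose graph is not properly included in the
graph of any other monotone operator. -/
def IsMaximalMonotoneOperator (T : X → Set (StrongDual ℝ X)) : Prop :=
  IsMonotoneOperator T ∧
    ∀ S : X → Set (StrongDual ℝ X), IsMonotoneOperator S → ¬ graph T ⊂ graph S

/-! A bifunction on `C ⊆ X` is represented by a map `F : X → X → ℝ`, of which only the values
`F x y` with `x ∈ C` and `y ∈ C` are ever used. -/

/-- A monotone bifunction on `C`. -/
def IsMonotoneBifunction (C : Set X) (F : X → X → ℝ) : Prop :=
  ∀ x ∈ C, ∀ y ∈ C, F x y + F y x ≤ 0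

/-- The operator `A^F : X ⇉ X*` of a bifunction `F` on `C`; it is empty-valued outside `C`. -/
def diagonalOperator (C : Set X) (F : X → X → ℝ) (x : X) : Set (StrongDual ℝ X) :=
  {x' | x ∈ C ∧ ∀ y ∈ C, x' (y - x) ≤ F x y - F x x}

/-- A maximal monotone bifunction on `C`: it is monotone and `A^F` is a maximal monotone
operator. -/
def IsMaximalMonotoneBifunction (C : Set X) (F : X → X → ℝ) : Prop :=
  IsMonotoneBifunction C F ∧ IsMaximalMonotoneOperator (diagonalOperator C F)

/-- A Blum-Oettli maximal monotone bifunction on `C`. -/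
def IsBOMaximalMonotoneBifunction (C : Set X) (F : X → X → ℝ) : Prop :=
  IsMonotoneBifunction C F ∧
    ∀ x ∈ C, ∀ x' : StrongDual ℝ X,
      (∀ y ∈ C, F y x + x' (y - x) ≤ 0) → ∀ y ∈ C, x' (y - x) ≤ F x y

end BifunctionTheory

open Filter Topology

/-! Let `(x, x')` be monotonically related to the graph of `A^F`, and let `p ∈ sqri C`. The
existence arguments rest on one compactness principle: functionals that are pointwise bounded above
on `C - p` converge pointwise on `C - p` along every ultrafilter, because `C - p` is an absorbing
subset of a Banach space `V`, where Banach-Steinhaus and Banach-Alaoglu apply.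

This yields subgradients of `F w` at every `w ∈ sqri C`. Let `b ∈ C` lie between `x` and `p`. Each
`w ∈ sqri C` on the segment from `b` to `p` carries some `y' ∈ A^F w`, and `x' (p - b) ≤ y' (p - b)`
since `x'` and `y'` are monotonically related; this one-sided bound suffices for compactness as
`w → b`, and Blum-Oettli maximality puts the limit `ℓ` into `A^F b`.

* If `x ∉ C`, take for `b` the point where the segment from `x` to `p` enters `C`. Some `m` normal
  to `C` at `b` has `m (b - x) < 0`, and `ℓ + s m ∈ A^F b` for all `s ≥ 0` contradicts monotone
  relatedness. Hence `x ∈ C`.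
* Taking `b = x` gives `x' (p - x) ≤ ℓ (p - x) ≤ F x p` for every `p ∈ sqri C`. The inequality
  extends to `C` by convexity, so `x' ∈ A^F x`. -/

namespace BifunctionTheory

theorem le_of_tendsto_of_lowerSemicontinuousWithinAt {α β ι : Type*} [TopologicalSpace α]
    [TopologicalSpace β] [LinearOrder β] [DenselyOrdered β] [OrderTopology β] {s : Set α}
    {f : α → β} {a : α} (hf : LowerSemicontinuousWithinAt f s a) {l : Filter ι} [l.NeBot]
    {w : ι → α} (hw : Tendsto w l (𝓝[s] a)) {g : ι → β} {L : β} (hg : Tendsto g l (𝓝 L))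
    (hfg : ∀ᶠ i in l, f (w i) ≤ g i) : f a ≤ L :=
  le_of_forall_lt_imp_le_of_dense fun m hm =>
    ge_of_tendsto hg <| ((hw.eventually (hf m hm)).and hfg).mono fun _ hi => (hi.1.trans_le hi.2).le

theorem bddBelow_image_segment {E : Type*} [AddCommGroup E] [Module ℝ E] [TopologicalSpace E]
    [IsTopologicalAddGroup E] [ContinuousSMul ℝ E] {C : Set E} (hconv : Convex ℝ C) {f : E → ℝ}
    (hf : LowerSemicontinuousOn f C) {a b : E} (ha : a ∈ C) (hb : b ∈ C) :
    BddBelow (f '' segment ℝ a b) := by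
  refine (hf.mono (hconv.segment_subset ha hb)).bddBelow_of_isCompact ?_
  rw [segment_eq_image_lineMap]
  exact isCompact_Icc.image AffineMap.lineMap_continuous

theorem exists_tendsto_apply_of_pointwise_bounded {𝕜 E ι : Type*} [NontriviallyNormedField 𝕜]
    [ProperSpace 𝕜] [SeminormedAddCommGroup E] [NormedSpace 𝕜 E] [CompleteSpace E]
    (U : Ultrafilter ι) {z : ι → StrongDual 𝕜 E} (hz : ∀ v, ∃ K, ∀ i, ‖z i v‖ ≤ K) :
    ∃ ℓ : StrongDual 𝕜 E, ∀ v, Tendsto (fun i => z i v) U (𝓝 (ℓ v)) := by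
  obtain ⟨M, hM⟩ := banach_steinhaus hz
  obtain ⟨ℓ, -, hℓ⟩ := (WeakDual.isCompact_closedBall (0 : StrongDual 𝕜 E) M).ultrafilter_le_nhds
    (U.map fun i => StrongDual.toWeakDual (z i)) (by
      rw [Ultrafilter.coe_map, le_principal_iff, mem_map]
      exact univ_mem' fun i => by simpa using hM i)
  exact ⟨WeakDual.toStrongDual ℓ, fun v => ((WeakDual.eval_continuous v).tendsto ℓ).comp hℓ⟩

theorem exists_apply_sub_eq_one_of_notMem {E : Type*} [AddCommGroup E] [Module ℝ E]
    [TopologicalSpace E] [IsTopologicalAddGroup E] [ContinuousSMul ℝ E] [LocallyConvexSpace ℝ E]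
    {C : Set E} (hC : IsClosed C) (hconv : Convex ℝ C) {p y : E} (hp : p ∈ C) (hy : y ∉ C) :
    ∃ m : StrongDual ℝ E, m (y - p) = 1 ∧ ∀ c ∈ C, m (c - p) ≤ 1 := by
  obtain ⟨f, s, hfC, hfy⟩ := geometric_hahn_banach_closed_point hconv hC hy
  have hpos : 0 < f (y - p) := by rw [map_sub]; linarith [hfC p hp]
  refine ⟨(f (y - p))⁻¹ • f, inv_mul_cancel₀ hpos.ne', fun c hc => ?_⟩
  have hle : f (c - p) ≤ f (y - p) := by simp only [map_sub]; linarith [hfC c hc]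
  simpa using inv_mul_le_one_of_le₀ hle hpos.le

theorem exists_vanishing_functional_of_notMem {E : Type*} [AddCommGroup E] [Module ℝ E]
    [TopologicalSpace E] [IsTopologicalAddGroup E] [ContinuousSMul ℝ E] [LocallyConvexSpace ℝ E]
    {V : Submodule ℝ E} (hV : IsClosed (V : Set E)) {d : E} (hd : d ∉ V) :
    ∃ m : StrongDual ℝ E, (∀ v ∈ V, m v = 0) ∧ 0 < m d := by
  obtain ⟨m, s, hmV, hmd⟩ := geometric_hahn_banach_closed_point V.convex hV hd
  have hs : 0 < s := by simpa using hmV 0 V.zero_mem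
  refine ⟨m, fun v hv => ?_, hs.trans hmd⟩
  by_contra hne
  have := hmV ((s / m v) • v) (V.smul_mem _ hv)
  rw [map_smul, smul_eq_mul, div_mul_cancel₀ _ hne] at this
  exact this.false

section StrongQuasiRelativeInterior

theorem mem_sqri_iff {X : Type*} [AddCommGroup X] [Module ℝ X] [TopologicalSpace X] {C : Set X}
    {p : X} : p ∈ sqri C ↔ p ∈ C ∧ ∃ V : Submodule ℝ X, IsClosed (V : Set X) ∧
      (∀ c ∈ C, c - p ∈ V) ∧ ∀ u ∈ V, ∃ δ : ℝ, 0 < δ ∧ p + δ • u ∈ C := by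
  refine and_congr_right fun hp => exists_congr fun V => and_congr_right fun _ =>
    ⟨fun hcone => ⟨fun c hc => ?_, fun u hu => ?_⟩, fun ⟨hsub, habs⟩ => Set.Subset.antisymm ?_ ?_⟩
  · rw [← SetLike.mem_coe, ← hcone]
    exact ⟨1, zero_le_one, c - p, ⟨c, hc, rfl⟩, (one_smul ℝ _).symm⟩
  · rw [← SetLike.mem_coe, ← hcone] at hu
    obtain ⟨t, ht, _, ⟨c, hc, rfl⟩, rfl⟩ := hu
    rcases ht.eq_or_lt with rfl | ht
    · exact ⟨1, one_pos, by simpa using hp⟩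
    · exact ⟨t⁻¹, inv_pos.2 ht, by simpa [smul_smul, inv_mul_cancel₀ ht.ne'] using hc⟩
  · rintro _ ⟨t, -, _, ⟨c, hc, rfl⟩, rfl⟩
    exact V.smul_mem t (hsub c hc)
  · intro u hu
    obtain ⟨δ, hδ, hc⟩ := habs u hu
    exact ⟨δ⁻¹, inv_nonneg.2 hδ.le, δ • u, ⟨_, hc, add_sub_cancel_left p _⟩,
      (inv_smul_smul₀ hδ.ne' u).symm⟩

theorem lineMap_mem_sqri {X : Type*} [AddCommGroup X] [Module ℝ X] [TopologicalSpace X] {C : Set X}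
    (hconv : Convex ℝ C) {c p : X} (hc : c ∈ C) (hp : p ∈ sqri C) {r : ℝ}
    (hr : r ∈ Set.Ioc (0 : ℝ) 1) : AffineMap.lineMap c p r ∈ sqri C := by
  obtain ⟨hpC, V, hV, hsub, habs⟩ := mem_sqri_iff.1 hp
  have hw : AffineMap.lineMap c p r ∈ C := hconv.lineMap_mem hc hpC ⟨hr.1.le, hr.2⟩
  refine mem_sqri_iff.2 ⟨hw, V, hV, fun q hq => ?_, fun u hu => ?_⟩
  · simpa using V.sub_mem (hsub q hq) (hsub _ hw)
  · obtain ⟨δ, hδ, hq⟩ := habs u hu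
    refine ⟨r * δ, mul_pos hr.1 hδ, ?_⟩
    convert hconv.lineMap_mem hc hq ⟨hr.1.le, hr.2⟩ using 1
    simp only [AffineMap.lineMap_apply_module]
    module

theorem nonneg_of_nonneg_on_sqri {X : Type*} [AddCommGroup X] [Module ℝ X] [TopologicalSpace X]
    {C : Set X} (hne : (sqri C).Nonempty) {g : X → ℝ} (hg : ConvexOn ℝ C g)
    (hpos : ∀ p ∈ sqri C, 0 ≤ g p) {c : X} (hc : c ∈ C) : 0 ≤ g c := by
  obtain ⟨p, hp⟩ := hne
  have hlim : Tendsto (fun r : ℝ => (1 - r) * g c + r * g p) (𝓝[>] 0)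
      (𝓝 ((1 - 0) * g c + 0 * g p)) :=
    (Continuous.tendsto (by fun_prop) 0).mono_left nhdsWithin_le_nhds
  rw [sub_zero, one_mul, zero_mul, add_zero] at hlim
  refine ge_of_tendsto hlim ?_
  filter_upwards [Ioc_mem_nhdsGT (zero_lt_one' ℝ)] with r hr
  have hw := hpos _ (lineMap_mem_sqri hg.1 hc hp hr)
  rw [AffineMap.lineMap_apply_module] at hw
  exact hw.trans (hg.2 hc hp.1 (sub_nonneg.2 hr.2) hr.1.le (sub_add_cancel 1 r))

variable {X : Type*} [NormedAddCommGroup X] [NormedSpace ℝ X] [CompleteSpace X] {C : Set X} {p : X}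

theorem exists_tendsto_apply_sub_of_mem_sqri (hp : p ∈ sqri C) {ι : Type*} (U : Ultrafilter ι)
    {z : ι → StrongDual ℝ X} (hz : ∀ c ∈ C, ∃ K, ∀ i, z i (c - p) ≤ K) :
    ∃ ℓ : StrongDual ℝ X, ∀ c ∈ C, Tendsto (fun i => z i (c - p)) U (𝓝 (ℓ (c - p))) := by
  obtain ⟨-, V, hV, hsub, habs⟩ := mem_sqri_iff.1 hp
  have : CompleteSpace V := hV.completeSpace_coe
  have hbdd : ∀ u ∈ V, ∃ K, ∀ i, z i u ≤ K := by
    intro u hu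
    obtain ⟨δ, hδ, hc⟩ := habs u hu
    obtain ⟨K, hK⟩ := hz _ hc
    refine ⟨K / δ, fun i => (le_div_iff₀' hδ).2 ?_⟩
    simpa using hK i
  obtain ⟨ℓ, hℓ⟩ := exists_tendsto_apply_of_pointwise_bounded U
    (z := fun i => (z i).comp V.subtypeL) fun u => by
      obtain ⟨K, hK⟩ := hbdd u u.2
      obtain ⟨K', hK'⟩ := hbdd (-u) (V.neg_mem u.2)
      exact ⟨max K K', fun i => abs_le'.2 ⟨(hK i).trans (le_max_left _ _),
        (map_neg (z i) (u : X)).ge.trans ((hK' i).trans (le_max_right _ _))⟩⟩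
  obtain ⟨m, hm, -⟩ := exists_extension_norm_eq V ℓ
  exact ⟨m, fun c hc => (hm ⟨c - p, hsub c hc⟩).symm ▸ hℓ ⟨c - p, hsub c hc⟩⟩

-- The subgradient is a limit of affine minorants whose values at `p` tend to `g p`.
theorem exists_subgradient_of_mem_sqri (hC : IsClosed C) (hp : p ∈ sqri C) {g : X → ℝ}
    (hg : ConvexOn ℝ C g) (hlsc : LowerSemicontinuousOn g C) :
    ∃ ℓ : StrongDual ℝ X, ∀ c ∈ C, ℓ (c - p) ≤ g c - g p := by
  obtain ⟨r, -, hr, hrlim⟩ := exists_seq_strictAnti_tendsto' (zero_lt_one' ℝ)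
  have hminorant : ∀ n, ∃ l : StrongDual ℝ X, ∀ c ∈ C, l (c - p) ≤ g c - g p + r n := by
    intro n
    obtain ⟨l, a, hl, hlp⟩ := hg.exists_affine_le_of_lt (𝕜 := ℝ) hp.1
      (sub_lt_self (g p) (hr n).1) hC hlsc
    refine ⟨l, fun c hc => ?_⟩
    have hlc : l c + a ≤ g c := hl ⟨c, hc⟩
    have hlp' : l p + a = g p - r n := hlp
    rw [map_sub]
    linarith
  choose l hl using hminorant
  obtain ⟨ℓ, hℓ⟩ := exists_tendsto_apply_sub_of_mem_sqri hp (hyperfilter ℕ) (z := l) fun c hc =>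
    ⟨g c - g p + 1, fun n => (hl n c hc).trans (by linarith [(hr n).2])⟩
  refine ⟨ℓ, fun c hc => le_of_tendsto_of_tendsto' (hℓ c hc) ?_ fun n => hl n c hc⟩
  simpa using (hrlim.mono_left Nat.hyperfilter_le_atTop).const_add (g c - g p)

end StrongQuasiRelativeInterior

variable {X : Type*} [NormedAddCommGroup X] [NormedSpace ℝ X] {C : Set X}

section NormalCone

/-- The normal cone of `C` at `b`, for arbitrary `b`: its elements support `C` at `b` if
`b ∈ C`. -/
def normalCone (C : Set X) (b : X) : Set (StrongDual ℝ X) :=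
  {m | ∀ c ∈ C, m (c - b) ≤ 0}

theorem exists_mem_normalCone_of_isVisible_of_mem_sqri {x p : X} (hp : p ∈ sqri C)
    (hconv : Convex ℝ C) (hxp : x ≠ p) (hvis : IsVisible ℝ C x p) :
    ∃ m ∈ normalCone C p, m (p - x) < 0 := by
  obtain ⟨hpC, V, hV, hsub, habs⟩ := mem_sqri_iff.1 hp
  have hxV : x - p ∉ V := by
    intro hmem
    obtain ⟨δ, hδ, hδC⟩ := habs _ hmem
    have hδ1 : 1 < 1 + δ := by linarith
    have hw : AffineMap.lineMap p (p + δ • (x - p)) (1 + δ)⁻¹ ∈ C :=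
      hconv.lineMap_mem hpC hδC ⟨by positivity, (inv_lt_one_of_one_lt₀ hδ1).le⟩
    have hwx : AffineMap.lineMap p (p + δ • (x - p)) (1 + δ)⁻¹
        = AffineMap.lineMap p x (δ / (1 + δ)) := by
      simp only [AffineMap.lineMap_apply_module']
      module
    rw [hwx] at hw
    refine hvis hw (sbtw_lineMap_iff.2 ⟨hxp.symm, by positivity, ?_⟩).symm
    exact (div_lt_one (by positivity)).2 (by linarith)
  obtain ⟨m, hmV, hm⟩ := exists_vanishing_functional_of_notMem hV hxV
  refine ⟨m, fun c hc => (hmV _ (hsub c hc)).le, ?_⟩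
  rwa [← neg_sub x p, map_neg, neg_lt_zero]

theorem exists_mem_normalCone_of_sbtw [CompleteSpace X] (hC : IsClosed C) (hconv : Convex ℝ C)
    {x b p : X} (hp : p ∈ sqri C) (hb : b ∈ C) (hxbp : Sbtw ℝ x b p) (hvis : IsVisible ℝ C x b) :
    ∃ m ∈ normalCone C b, m (b - x) < 0 := by
  obtain ⟨κ, hκ, hray⟩ := hxbp.wbtw.sameRay_vsub.exists_pos_right
    (vsub_ne_zero.2 hxbp.ne_left) (vsub_ne_zero.2 hxbp.ne_right.symm)
  simp only [vsub_eq_sub] at hray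
  obtain ⟨r, -, hr, hrlim⟩ := exists_seq_strictAnti_tendsto' (zero_lt_one' ℝ)
  have houtside : ∀ n, AffineMap.lineMap b x (r n) ∉ C := fun n hmem =>
    hvis hmem (sbtw_lineMap_iff.2 ⟨hxbp.ne_left, hr n⟩).symm
  choose z hz1 hzC using fun n => exists_apply_sub_eq_one_of_notMem hC hconv hp.1 (houtside n)
  obtain ⟨m, hm⟩ := exists_tendsto_apply_sub_of_mem_sqri hp (hyperfilter ℕ) (z := z) fun c hc =>
    ⟨1, fun n => hzC n c hc⟩
  have hmC : ∀ c ∈ C, m (c - p) ≤ 1 := fun c hc => le_of_tendsto' (hm c hc) fun n => hzC n c hc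
  have hmb : m (b - p) = 1 := by
    have hlim : Tendsto (fun n => (1 + κ * r n) * z n (b - p)) (hyperfilter ℕ)
        (𝓝 ((1 + κ * 0) * m (b - p))) :=
      (((hrlim.mono_left Nat.hyperfilter_le_atTop).const_mul κ).const_add 1).mul (hm b hb)
    have hconst : ∀ n, (1 + κ * r n) * z n (b - p) = 1 := by
      intro n
      have hpoint : (1 + κ * r n) • (b - p) = AffineMap.lineMap b x (r n) - p := by
        rw [AffineMap.lineMap_apply_module', ← neg_sub b x, hray]
        module
      rw [← smul_eq_mul, ← map_smul, hpoint, hz1]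
    simp only [hconst, mul_zero, add_zero, one_mul] at hlim
    exact tendsto_nhds_unique hlim tendsto_const_nhds
  refine ⟨m, fun c hc => ?_, ?_⟩
  · rw [← sub_sub_sub_cancel_right c b p, map_sub, hmb, sub_nonpos]
    exact hmC c hc
  · rw [hray, ← neg_sub b p, map_smul, map_neg, hmb]
    simpa using hκ

theorem exists_wbtw_normalCone_of_notMem [CompleteSpace X] (hC : IsClosed C) (hconv : Convex ℝ C)
    {x p : X} (hp : p ∈ sqri C) (hx : x ∉ C) :
    ∃ b ∈ C, Wbtw ℝ x b p ∧ ∃ m ∈ normalCone C b, m (b - x) < 0 := by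
  obtain ⟨b, hb, hxbp, hvis⟩ := hC.exists_wbtw_isVisible hp.1 x
  refine ⟨b, hb, hxbp, ?_⟩
  have hbx : b ≠ x := ne_of_mem_of_not_mem hb hx
  rcases eq_or_ne b p with rfl | hbp
  · exact exists_mem_normalCone_of_isVisible_of_mem_sqri hp hconv hbx.symm hvis
  · exact exists_mem_normalCone_of_sbtw hC hconv hp hb ⟨hxbp, hbx, hbp⟩ hvis

end NormalCone

section MonotonicallyRelated

/-- The pair `(x, x')` is monotonically related to the graph of `T`: adding it to the graph of a
monotone operator `T` keeps that operator monotone. -/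
def IsMonotonicallyRelated (T : X → Set (StrongDual ℝ X)) (x : X) (x' : StrongDual ℝ X) : Prop :=
  ∀ y, ∀ y' ∈ T y, 0 ≤ (y' - x') (y - x)

theorem IsMonotoneOperator.isMaximal_of_isMonotonicallyRelated {T : X → Set (StrongDual ℝ X)}
    (hT : IsMonotoneOperator T) (h : ∀ x x', IsMonotonicallyRelated T x x' → x' ∈ T x) :
    IsMaximalMonotoneOperator T :=
  ⟨hT, fun _ hS hsub => hsub.2 fun q hq => h q.1 q.2 fun y y' hy' =>
    hS q.1 y q.2 hq y' (hsub.1 (show (y, y') ∈ graph T from hy'))⟩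

theorem IsMonotonicallyRelated.apply_sub_le_of_mem_lineMap {T : X → Set (StrongDual ℝ X)}
    {x b p : X} {x' y' : StrongDual ℝ X} (hrel : IsMonotonicallyRelated T x x')
    (hxbp : Wbtw ℝ x b p) {r : ℝ} (hr : r ∈ Set.Ioc (0 : ℝ) 1)
    (hy' : y' ∈ T (AffineMap.lineMap b p r)) : x' (p - b) ≤ y' (p - b) := by
  obtain ⟨t, ⟨ht0, ht1⟩, rfl⟩ := hxbp
  set b := AffineMap.lineMap x p t with hb
  have hwx : AffineMap.lineMap b p r - x = (t * (1 - r) + r) • (p - x) := by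
    simp only [hb, AffineMap.lineMap_apply_module']
    module
  have hpb : p - b = (1 - t) • (p - x) := by
    simp only [hb, AffineMap.lineMap_apply_module']
    module
  have hcoeff : 0 < t * (1 - r) + r := by
    linarith [mul_nonneg ht0 (sub_nonneg.2 hr.2), hr.1]
  have hdir : 0 ≤ (y' - x') (p - x) := by
    have := hrel _ y' hy'
    rw [hwx, map_smul, smul_eq_mul] at this
    exact nonneg_of_mul_nonneg_right this hcoeff
  rw [← sub_nonneg, ← sub_apply, hpb, map_smul]
  exact mul_nonneg (sub_nonneg.2 ht1) hdir

end MonotonicallyRelated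

section DiagonalOperator

variable {F : X → X → ℝ}

theorem add_smul_mem_diagonalOperator {b : X} {ℓ m : StrongDual ℝ X}
    (hℓ : ℓ ∈ diagonalOperator C F b) (hm : m ∈ normalCone C b) {s : ℝ} (hs : 0 ≤ s) :
    ℓ + s • m ∈ diagonalOperator C F b := by
  refine ⟨hℓ.1, fun c hc => ?_⟩
  rw [add_apply, smul_apply]
  exact (add_le_of_nonpos_right (mul_nonpos_of_nonneg_of_nonpos hs (hm c hc))).trans (hℓ.2 c hc)

theorem IsMonotonicallyRelated.apply_sub_nonneg_of_mem_normalCone {x b : X}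
    {x' ℓ m : StrongDual ℝ X} (hrel : IsMonotonicallyRelated (diagonalOperator C F) x x')
    (hℓ : ℓ ∈ diagonalOperator C F b) (hm : m ∈ normalCone C b) : 0 ≤ m (b - x) := by
  by_contra! hneg
  have hℓ0 : 0 ≤ (ℓ - x') (b - x) := hrel b ℓ hℓ
  set s : ℝ := ((ℓ - x') (b - x) + 1) / -m (b - x) with hs
  have hs0 : 0 ≤ s := div_nonneg (by linarith) (by linarith)
  have hsm : s * m (b - x) = -((ℓ - x') (b - x) + 1) := by
    rw [hs, div_neg, neg_mul, div_mul_cancel₀ _ hneg.ne]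
  have := hrel b _ (add_smul_mem_diagonalOperator hℓ hm hs0)
  rw [add_sub_right_comm, add_apply, smul_apply, smul_eq_mul, hsm] at this
  linarith

theorem IsMonotoneBifunction.apply_le_of_mem_diagonalOperator (hF : IsMonotoneBifunction C F)
    {w q : X} (hw : F w w = 0) {y' : StrongDual ℝ X} (hy' : y' ∈ diagonalOperator C F w)
    (hq : q ∈ C) : F q w ≤ y' (w - q) := by
  have hsub := hy'.2 q hq
  rw [hw, sub_zero, ← neg_sub w, map_neg] at hsub
  linarith [hF w hy'.1 q hq]

theorem IsMonotoneBifunction.apply_sub_le_of_mem_lineMap (hF : IsMonotoneBifunction C F)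
    {b p q : X} {r : ℝ} (hw : F (AffineMap.lineMap b p r) (AffineMap.lineMap b p r) = 0)
    {y' : StrongDual ℝ X} (hy' : y' ∈ diagonalOperator C F (AffineMap.lineMap b p r))
    (hq : q ∈ C) : y' (q - p) ≤ -F q (AffineMap.lineMap b p r) - (1 - r) * y' (p - b) := by
  have hFq := hF.apply_le_of_mem_diagonalOperator hw hy' hq
  have hsplit : AffineMap.lineMap b p r - q = -((1 - r) • (p - b) + (q - p)) := by
    rw [AffineMap.lineMap_apply_module']
    module
  rw [hsplit, map_neg, map_add, map_smul, smul_eq_mul] at hFq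
  linarith

theorem IsMonotoneBifunction.isMonotoneOperator_diagonalOperator (hF : IsMonotoneBifunction C F)
    (hdiag : ∀ x ∈ C, F x x = 0) : IsMonotoneOperator (diagonalOperator C F) := by
  intro x y x' hx' y' hy'
  have hxy : x' (y - x) ≤ F x y := by simpa [hdiag x hx'.1] using hx'.2 y hy'.1
  rw [sub_apply, sub_nonneg]
  exact hxy.trans (hF.apply_le_of_mem_diagonalOperator (hdiag y hy'.1) hy' hx'.1)

theorem IsBOMaximalMonotoneBifunction.mem_diagonalOperator_of_tendsto
    (hF : IsBOMaximalMonotoneBifunction C F) (hdiag : ∀ x ∈ C, F x x = 0) {b : X} (hb : b ∈ C)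
    (hlsc : ∀ q ∈ C, LowerSemicontinuousWithinAt (F q) C b) {ι : Type*} {l : Filter ι} [l.NeBot]
    {w : ι → X} (hw : Tendsto w l (𝓝 b)) {y' : ι → StrongDual ℝ X}
    (hy' : ∀ i, y' i ∈ diagonalOperator C F (w i)) {ℓ : StrongDual ℝ X}
    (hlim : ∀ q ∈ C, Tendsto (fun i => y' i (w i - q)) l (𝓝 (ℓ (b - q)))) :
    ℓ ∈ diagonalOperator C F b := by
  have hwC : Tendsto w l (𝓝[C] b) :=
    tendsto_nhdsWithin_iff.2 ⟨hw, Eventually.of_forall fun i => (hy' i).1⟩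
  have hle : ∀ q ∈ C, F q b ≤ ℓ (b - q) := fun q hq =>
    le_of_tendsto_of_lowerSemicontinuousWithinAt (hlsc q hq) hwC (hlim q hq) <|
      Eventually.of_forall fun i =>
        hF.1.apply_le_of_mem_diagonalOperator (hdiag _ (hy' i).1) (hy' i) hq
  refine ⟨hb, fun q hq => ?_⟩
  rw [hdiag b hb, sub_zero]
  refine hF.2 b hb ℓ (fun c hc => ?_) q hq
  rw [← neg_sub b c, map_neg]
  linarith [hle c hc]

end DiagonalOperator

section MaximalMonotonicity

variable [CompleteSpace X] {F : X → X → ℝ} {x : X} {x' : StrongDual ℝ X}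

theorem IsMonotonicallyRelated.exists_mem_diagonalOperator_of_wbtw
    (hrel : IsMonotonicallyRelated (diagonalOperator C F) x x') (hC : IsClosed C)
    (hconv : Convex ℝ C) (hdiag : ∀ x ∈ C, F x x = 0) (hF : IsBOMaximalMonotoneBifunction C F)
    (hFconv : ∀ x ∈ C, ConvexOn ℝ C (F x)) (hlsc : ∀ x ∈ C, LowerSemicontinuousOn (F x) C)
    {p : X} (hp : p ∈ sqri C) {b : X} (hb : b ∈ C) (hxbp : Wbtw ℝ x b p) :
    ∃ ℓ ∈ diagonalOperator C F b, x' (p - b) ≤ ℓ (p - b) := by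
  obtain ⟨r, -, hr, hrlim⟩ := exists_seq_strictAnti_tendsto' (zero_lt_one' ℝ)
  replace hrlim : Tendsto r (hyperfilter ℕ) (𝓝 0) := hrlim.mono_left Nat.hyperfilter_le_atTop
  have hr' : ∀ n, r n ∈ Set.Ioc (0 : ℝ) 1 := fun n => Set.Ioo_subset_Ioc_self (hr n)
  let w : ℕ → X := fun n => AffineMap.lineMap b p (r n)
  have hw : ∀ n, w n ∈ sqri C := fun n => lineMap_mem_sqri hconv hb hp (hr' n)
  have hwlim : Tendsto w (hyperfilter ℕ) (𝓝 b) := by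
    simpa [w, AffineMap.lineMap_apply_module'] using (hrlim.smul_const (p - b)).add_const b
  choose y' hsub using fun n =>
    exists_subgradient_of_mem_sqri hC (hw n) (hFconv _ (hw n).1) (hlsc _ (hw n).1)
  have hy' : ∀ n, y' n ∈ diagonalOperator C F (w n) := fun n => ⟨(hw n).1, hsub n⟩
  have hdir : ∀ n, x' (p - b) ≤ y' n (p - b) := fun n =>
    hrel.apply_sub_le_of_mem_lineMap hxbp (hr' n) (hy' n)
  have hbdd : ∀ q ∈ C, ∃ K, ∀ n, y' n (q - p) ≤ K := by
    intro q hq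
    obtain ⟨M, hM⟩ := bddBelow_image_segment hconv (hlsc q hq) hb hp.1
    refine ⟨|x' (p - b)| - M, fun n => ?_⟩
    have hMn : M ≤ F q (w n) := hM ⟨_, lineMap_mem_segment ℝ b p ⟨(hr n).1.le, (hr n).2.le⟩, rfl⟩
    have hslope : -|x' (p - b)| ≤ (1 - r n) * y' n (p - b) := calc
      -|x' (p - b)| ≤ (1 - r n) * -|x' (p - b)| := by
        linarith [mul_nonneg (hr n).1.le (abs_nonneg (x' (p - b)))]
      _ ≤ (1 - r n) * y' n (p - b) :=
        mul_le_mul_of_nonneg_left ((neg_abs_le _).trans (hdir n)) (sub_nonneg.2 (hr n).2.le)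
    linarith [hF.1.apply_sub_le_of_mem_lineMap (hdiag _ (hw n).1) (hy' n) hq]
  obtain ⟨ℓ, hℓ⟩ := exists_tendsto_apply_sub_of_mem_sqri hp (hyperfilter ℕ) hbdd
  have hℓpb : Tendsto (fun n => y' n (p - b)) (hyperfilter ℕ) (𝓝 (ℓ (p - b))) := by
    simpa only [← map_neg, neg_sub] using (hℓ b hb).neg
  refine ⟨ℓ, hF.mem_diagonalOperator_of_tendsto hdiag hb (fun q hq => hlsc q hq b hb) hwlim hy'
    fun q hq => ?_, ge_of_tendsto' hℓpb hdir⟩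
  have hlim := ((hℓ b hb).sub (hℓ q hq)).add (hrlim.mul hℓpb)
  rw [← map_sub, sub_sub_sub_cancel_right, zero_mul, add_zero] at hlim
  refine hlim.congr fun n => ?_
  rw [← map_sub, ← smul_eq_mul, ← map_smul, ← map_add]
  congr 1
  simp only [w, AffineMap.lineMap_apply_module']
  module

theorem IsMonotonicallyRelated.mem_of_sqri_nonempty
    (hrel : IsMonotonicallyRelated (diagonalOperator C F) x x') (hC : IsClosed C)
    (hconv : Convex ℝ C) (hne : (sqri C).Nonempty) (hdiag : ∀ x ∈ C, F x x = 0)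
    (hF : IsBOMaximalMonotoneBifunction C F) (hFconv : ∀ x ∈ C, ConvexOn ℝ C (F x))
    (hlsc : ∀ x ∈ C, LowerSemicontinuousOn (F x) C) : x ∈ C := by
  by_contra hx
  obtain ⟨p, hp⟩ := hne
  obtain ⟨b, hb, hxbp, m, hm, hneg⟩ := exists_wbtw_normalCone_of_notMem hC hconv hp hx
  obtain ⟨ℓ, hℓ, -⟩ :=
    hrel.exists_mem_diagonalOperator_of_wbtw hC hconv hdiag hF hFconv hlsc hp hb hxbp
  exact hneg.not_ge (hrel.apply_sub_nonneg_of_mem_normalCone hℓ hm)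

theorem IsMonotonicallyRelated.mem_diagonalOperator
    (hrel : IsMonotonicallyRelated (diagonalOperator C F) x x') (hC : IsClosed C)
    (hconv : Convex ℝ C) (hne : (sqri C).Nonempty) (hdiag : ∀ x ∈ C, F x x = 0)
    (hF : IsBOMaximalMonotoneBifunction C F) (hFconv : ∀ x ∈ C, ConvexOn ℝ C (F x))
    (hlsc : ∀ x ∈ C, LowerSemicontinuousOn (F x) C) : x' ∈ diagonalOperator C F x := by
  have hx : x ∈ C := hrel.mem_of_sqri_nonempty hC hconv hne hdiag hF hFconv hlsc
  have hsqri : ∀ p ∈ sqri C, 0 ≤ F x p - x' (p - x) := by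
    intro p hp
    obtain ⟨ℓ, hℓ, hle⟩ := hrel.exists_mem_diagonalOperator_of_wbtw hC hconv hdiag hF hFconv hlsc
      hp hx (wbtw_self_left ℝ x p)
    linarith [hℓ.2 p hp.1, hdiag x hx]
  have hgconv : ConvexOn ℝ C fun y => F x y - x' (y - x) := by
    have hsplit : (fun y => F x y - x' (y - x)) = fun y => F x y - x' y + x' x := by
      funext y
      rw [map_sub]
      ring
    rw [hsplit]
    exact ((hFconv x hx).sub (x'.toLinearMap.concaveOn hconv)).add_const (x' x)
  refine ⟨hx, fun y hy => ?_⟩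
  rw [hdiag x hx, sub_zero]
  exact sub_nonneg.1 (nonneg_of_nonneg_on_sqri hne hgconv hsqri hy)

end MaximalMonotonicity

end BifunctionTheory

theorem mainTheorem10 {X : Type*} [NormedAddCommGroup X] [NormedSpace ℝ X] [CompleteSpace X]
    (C : Set X) (hCclosed : IsClosed C) (hCconvex : Convex ℝ C)
    (hCsqri : (BifunctionTheory.sqri C).Nonempty)
    (F : X → X → ℝ) (hFdiag : ∀ x ∈ C, F x x = 0)
    (hFBO : BifunctionTheory.IsBOMaximalMonotoneBifunction C F)
    (hFconvex : ∀ x ∈ C, ConvexOn ℝ C (F x))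
    (hFlsc : ∀ x ∈ C, LowerSemicontinuousOn (F x) C) :
    BifunctionTheory.IsMaximalMonotoneBifunction C F := by
  have hmono := hFBO.1.isMonotoneOperator_diagonalOperator hFdiag
  exact ⟨hFBO.1, hmono.isMaximal_of_isMonotonicallyRelated fun _ _ hrel =>
    hrel.mem_diagonalOperator hCclosed hCconvex hCsqri hFdiag hFBO hFconvex hFlsc⟩
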